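/- **Terminology.** A \emph{C*-inclusion} $(\mathcal C,\mathcal D)$ is a nonzero unital C*-algebra $\mathcal C$ with a unital C*-subalgebra $\mathcal D\subseteq\mathcal C$ (same unit); it is \emph{abelian} if $\mathcal C$ is. A \emph{conditional expectation} for $(\mathcal C,\mathcal D)$ is a contractive linear projection of $\mathcal C$ onto $\mathcal D$. The \emph{injective envelope} $I(\mathcal D)$ is the (essentially unique) minimal injective object containing $\mathcal D$ in the category of operator systems and unital completely positive (ucp) maps; it is a unital C*-algebra containing $\mathcal D$ as a unital C*-subalgebra. A \emph{pseudo-expectation} for $(\mathcal C,\mathcal D)$ is a ucp map $\theta:\mathcal C\to I(\mathcal D)$ with $\theta|_{\mathcal D}=\mathrm{id}$. **Statement.** (1) Let $(\mathcal A,\mathcal D)$ be an abelian C*-inclusion such that the only completely positive $\mathcal D$-bimodule map $\theta:\mathcal A\to\mathcal D$ is $\theta=0$. Let $\tilde{\mathcal D}=\{d\oplus d: d\in\mathcal D\}\subseteq\mathcal A\oplus\mathcal D$. Then $(\mathcal A\oplus\mathcal D,\tilde{\mathcal D})$ is an abelian C*-inclusion which has exactly one conditional expectation; moreover $\tilde{\mathcal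 D}$ has an injective envelope, and, for every choice of it, $(\mathcal A\oplus\mathcal D,\tilde{\mathcal D})$ has infinitely many pseudo-expectations. (2) The hypothesis of (1) is satisfied by $\mathcal A=C(\{0,1\}^{\mathbb N})$ and $\mathcal D=\{f\circ j: f\in C([0,1])\}$, where $j:\{0,1\}^{\mathbb N}\to[0,1]$ is the continuous surjection $j((a_n)_{n\ge1})=\sum_{n\ge1}a_n2^{-n}$. (3) Consequently there is an abelian C*-inclusion which has exactly one conditional expectation but infinitely many pseudo-expectations. -/

import Mathlib

universe u v

namespace CStarInclusion

/-- A square matrix over a C⋆-algebra is positive if it has the form `X⋆ X`. -/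
def MatrixPositive {B : Type*} [Ring B] [StarRing B] {n : ℕ}
    (M : Matrix (Fin n) (Fin n) B) : Prop :=
  ∃ X : Matrix (Fin n) (Fin n) B, M = X.conjTranspose * X

/-- A linear map `φ : B → C` is completely positive if all of its entrywise amplifications
`Mₙ(B) → Mₙ(C)` preserve positivity. -/
def IsCompletelyPositive {B : Type*} {C : Type*} [Ring B] [StarRing B] [Algebra ℂ B]
    [Ring C] [StarRing C] [Algebra ℂ C] (φ : B →ₗ[ℂ] C) : Prop :=
  ∀ (n : ℕ) (M : Matrix (Fin n) (Fin n) B), MatrixPositive M → MatrixPositive (M.map φ)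

/-- An operator system in a unital C⋆-algebra: a self-adjoint linear subspace containing `1`. -/
structure IsOperatorSystem {B : Type*} [CStarAlgebra B] (E : Submodule ℂ B) : Prop where
  one_mem : (1 : B) ∈ E
  star_mem : ∀ x ∈ E, star x ∈ E

/-- Unital completely positive maps between operator systems `E ⊆ B` and `S ⊆ C`. A matrix over
`E` is positive when it is positive as a matrix over `B`, and similarly for `S`. -/
structure IsUCP {B : Type*} {C : Type*} [CStarAlgebra B] [CStarAlgebra C] {E : Submodule ℂ B}
    {S : Submodule ℂ C} (φ : E →ₗ[ℂ] S) : Prop where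
  map_one : ∀ e : E, (e : B) = 1 → (φ e : C) = 1
  map_pos : ∀ (n : ℕ) (M : Matrix (Fin n) (Fin n) E),
    MatrixPositive (M.map fun e => (e : B)) → MatrixPositive (M.map fun e => (φ e : C))

/-- An operator system `S` is injective (in the category of operator systems and ucp maps) if for
all operator systems `E ⊆ F`, every ucp map `E → S` extends to a ucp map `F → S`. -/
def IsInjectiveOperatorSystem {I : Type u} [CStarAlgebra I] (S : Submodule ℂ I) : Prop :=
  IsOperatorSystem S ∧
    ∀ (B : Type u) [CStarAlgebra B] (E F : Submodule ℂ B),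
      IsOperatorSystem E → IsOperatorSystem F → ∀ (hEF : E ≤ F) (φ : E →ₗ[ℂ] S), IsUCP φ →
        ∃ ψ : F →ₗ[ℂ] S, IsUCP ψ ∧ ∀ x : E, ψ (Submodule.inclusion hEF x) = φ x

/-- Hamana's injective envelope of a unital C⋆-algebra `D`: a unital C⋆-algebra `I` containing `D`
as a unital C⋆-subalgebra (through `κ`) which is an injective operator system, and is minimal
among the injective operator systems containing `D`. -/
structure IsInjectiveEnvelope {D : Type v} [Ring D] [StarRing D] [Algebra ℂ D]
    {I : Type u} [CStarAlgebra I] (κ : D →⋆ₐ[ℂ] I) : Prop where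
  injective_map : Function.Injective κ
  injective : IsInjectiveOperatorSystem (⊤ : Submodule ℂ I)
  minimal : ∀ S : Submodule ℂ I, (∀ d, κ d ∈ S) → IsInjectiveOperatorSystem S → S = ⊤

section Expectations

variable {C : Type u} [CStarAlgebra C] (D : StarSubalgebra ℂ C)

/-- A conditional expectation from `C` onto `D`: a contractive linear projection of `C` onto `D`. -/
structure IsConditionalExpectation (E : C →ₗ[ℂ] D) : Prop where
  contractive : ∀ x, ‖E x‖ ≤ ‖x‖
  map_coe : ∀ d : D, E d = d

/-- A `D`-bimodule map from `C` to `D`. -/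
def IsBimoduleMap (θ : C →ₗ[ℂ] D) : Prop :=
  ∀ (d₁ d₂ : D) (x : C), θ (d₁ * x * d₂) = d₁ * θ x * d₂

/-- A pseudo-expectation for `(C, D)`, with respect to an injective envelope `κ : D → I` of `D`:
a ucp map `θ : C → I` which restricts to the given embedding on `D`. -/
structure IsPseudoExpectation {I : Type u} [CStarAlgebra I] (κ : D →⋆ₐ[ℂ] I)
    (θ : C →ₗ[ℂ] I) : Prop where
  map_one : θ 1 = 1
  completelyPositive : IsCompletelyPositive θ
  map_coe : ∀ d : D, θ d = κ d

/-- `(C, D)` has exactly one conditional expectation. -/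
def HasUniqueConditionalExpectation : Prop :=
  ∃! E : C →ₗ[ℂ] D, IsConditionalExpectation D E

/-- `(C, D)` has infinitely many pseudo-expectations: `D` has an injective envelope, and whichever
model of the injective envelope is used, there are infinitely many pseudo-expectations into it. -/
def HasInfinitelyManyPseudoExpectations : Prop :=
  (∃ (I : Type u) (_ : CStarAlgebra I) (κ : D →⋆ₐ[ℂ] I), IsInjectiveEnvelope κ) ∧
    ∀ (I : Type u) [CStarAlgebra I] (κ : D →⋆ₐ[ℂ] I), IsInjectiveEnvelope κ →
      {θ : C →ₗ[ℂ] I | IsPseudoExpectation D κ θ}.Infinite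

end Expectations

/-- The diagonal copy `{d ⊕ d : d ∈ D}` of `D` in `A ⊕ D`. -/
def diagonal {A : Type u} [CStarAlgebra A] (D : StarSubalgebra ℂ A) :
    StarSubalgebra ℂ (A × D) :=
  (D.subtype.prod (StarAlgHom.id ℂ D)).range

/-- The Cantor-set surjection `(aₙ) ↦ ∑ aₙ / 2ⁿ` (indices from `1`) onto `[0, 1]`. -/
noncomputable def cantorSurjection : C(ℕ → Bool, unitInterval) :=
  ⟨Real.fromBinary, Real.fromBinary_continuous⟩

/-- The copy `{f ∘ j : f ∈ C([0, 1])}` of `C([0, 1])` in `C({0, 1}^ℕ)`, where `j` is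
`cantorSurjection`. -/
noncomputable def cantorSubalgebra : StarSubalgebra ℂ C(ℕ → Bool, ℂ) :=
  (ContinuousMap.compStarAlgHom' ℂ ℂ cantorSurjection).range

end CStarInclusion

/-! A conditional expectation onto the diagonal, read in `D`, is a unital contraction `F : A ⊕ D →
D` with `F (d, d) = d`. Contractivity makes it positive, and Cauchy–Schwarz at each character makes
it a `D`-module map (`map_diagonal_mul`). Its restriction to `A ⊕ 0` is then a completely positive
bimodule map, hence `0`, so that `F (a, d) = F (a - d, 0) + F (d, d) = d`.

For pseudo-expectations, `C(G, ℂ)` serves as a concrete envelope of `D`, where `G` is the projective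
cover of the character space. It is injective by `exists_positive_extension` and rigid over `D` by
`eq_id_of_irreducible`. The embedding `ι` of `D` extends to a positive map `Ψ` on `A`; then `(a, d)
↦ ι d` and `(a, d) ↦ Ψ a` differ at `(1, 0)`, and the segment between them is infinite. Any other
envelope receives `C(G, ℂ)` by an injective completely positive map over `D`.

In the Cantor example, the indicator of a clopen set splits the sequences at a dyadic point `c`. Its
image under `θ` is a continuous function on `[0, 1]` that vanishes left of `c` and equals `θ 1`
right of `c`, so `θ 1` vanishes at `c`. Density gives `θ 1 = 0`, and positivity gives `θ = 0`. -/

open scoped ComplexOrder ComplexStarModule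

namespace CStarInclusion

/-! ### Positivity in C⋆-algebras and contractive functionals -/

/-- An element of the form `star y * y`. -/
def IsStarSquare {B : Type*} [Mul B] [Star B] (a : B) : Prop := ∃ y : B, a = star y * y

theorem isStarSquare_iff_nonneg {B : Type*} [CStarAlgebra B] [PartialOrder B] [StarOrderedRing B]
    {a : B} : IsStarSquare a ↔ 0 ≤ a :=
  CStarAlgebra.nonneg_iff_eq_star_mul_self.symm

theorem IsStarSquare.map {B C F : Type*} [Mul B] [Star B] [Mul C] [Star C] [FunLike F B C]
    [MulHomClass F B C] [StarHomClass F B C] (f : F) {a : B} (h : IsStarSquare a) :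
    IsStarSquare (f a) := by
  obtain ⟨y, rfl⟩ := h
  exact ⟨f y, by rw [map_mul, map_star]⟩

theorem IsStarSquare.sum {B ι : Type*} [CStarAlgebra B] (s : Finset ι) {f : ι → B}
    (h : ∀ i ∈ s, IsStarSquare (f i)) : IsStarSquare (∑ i ∈ s, f i) := by
  let := CStarAlgebra.spectralOrder B
  have := CStarAlgebra.spectralOrderedRing B
  simp only [isStarSquare_iff_nonneg] at *
  exact Finset.sum_nonneg h

/-- A criterion in terms of the norm alone, so that isometric star homomorphisms reflect positivity
as well as preserve it. -/
theorem isStarSquare_iff_norm_sub_le {B : Type*} [CStarAlgebra B] {a : B} :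
    IsStarSquare a ↔ IsSelfAdjoint a ∧ ‖algebraMap ℂ B ‖a‖ - a‖ ≤ ‖a‖ := by
  let := CStarAlgebra.spectralOrder B
  have := CStarAlgebra.spectralOrderedRing B
  have e : algebraMap ℂ B ‖a‖ = algebraMap ℝ B ‖a‖ := by
    rw [IsScalarTower.algebraMap_apply ℝ ℂ B]; rfl
  rw [isStarSquare_iff_nonneg, e]
  constructor
  · intro ha
    have h1 : a ≤ algebraMap ℝ B ‖a‖ := (IsSelfAdjoint.of_nonneg ha).le_algebraMap_norm_self
    refine ⟨.of_nonneg ha, ?_⟩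
    rw [CStarAlgebra.norm_le_iff_le_algebraMap _ (norm_nonneg a) (sub_nonneg.2 h1)]
    exact sub_le_self _ ha
  · rintro ⟨ha, h⟩
    have hb : IsSelfAdjoint (algebraMap ℝ B ‖a‖ - a) :=
      ((IsSelfAdjoint.all (‖a‖ : ℝ)).algebraMap B).sub ha
    have h2 := hb.le_algebraMap_norm_self
    have h3 : algebraMap ℝ B ‖algebraMap ℝ B ‖a‖ - a‖ ≤ algebraMap ℝ B ‖a‖ := by
      rw [← sub_nonneg, ← map_sub]
      exact algebraMap_nonneg B (sub_nonneg.2 h)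
    have := h2.trans h3
    exact (sub_le_self_iff _).1 this

/-- Injective star homomorphisms of C⋆-algebras reflect positivity. -/
theorem IsStarSquare.of_map {D I : Type*} [CStarAlgebra D] [CStarAlgebra I] (κ : D →⋆ₐ[ℂ] I)
    (hκ : Function.Injective κ) {d : D} (h : IsStarSquare (κ d)) : IsStarSquare d := by
  rw [isStarSquare_iff_norm_sub_le] at h ⊢
  have hn : ∀ x, ‖κ x‖ = ‖x‖ := NonUnitalStarAlgHom.norm_map κ hκ
  refine ⟨hκ (by rw [map_star, h.1.star_eq]), ?_⟩
  rw [← hn, ← hn d, map_sub, AlgHomClass.commutes]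
  exact h.2

theorem im_eq_zero_of_contractive {B : Type*} [CStarAlgebra B] (f : B →ₗ[ℂ] ℂ) (h1 : f 1 = 1)
    (hc : ∀ x, ‖f x‖ ≤ ‖x‖) {a : B} (ha : IsSelfAdjoint a) : (f a).im = 0 := by
  -- Contractivity at `a + it`, whose squared norm is at most `‖a‖ ^ 2 + t ^ 2`. The `t ^ 2` terms
  -- cancel, leaving a bound on a linear function of `t`.
  have key : ∀ t : ℝ, ((f a).im + t) ^ 2 ≤ ‖a‖ ^ 2 + t ^ 2 := by
    intro t
    set b : B := a + algebraMap ℂ B (t * Complex.I) with hb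
    have hfb : f b = f a + t * Complex.I := by
      rw [hb, map_add, Algebra.algebraMap_eq_smul_one, map_smul, h1, smul_eq_mul, mul_one]
    have hbb : star b * b = a * a + algebraMap ℂ B ((t : ℂ) ^ 2) := by
      have : star (algebraMap ℂ B (t * Complex.I)) = - algebraMap ℂ B (t * Complex.I) := by
        rw [← algebraMap_star_comm, ← map_neg]; simp
      rw [hb, star_add, this, ha.star_eq, add_mul, mul_add, mul_add,
        ← Algebra.commutes (t * Complex.I) a, neg_mul, neg_mul, ← map_mul]
      have : (t * Complex.I * (t * Complex.I) : ℂ) = - (t : ℂ) ^ 2 := by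
        linear_combination (t : ℂ) ^ 2 * Complex.I_mul_I
      rw [this, map_neg]
      abel
    have hn : ‖b‖ ^ 2 ≤ ‖a‖ ^ 2 + t ^ 2 := by
      rw [sq, ← CStarRing.norm_star_mul_self, hbb]
      refine (norm_add_le _ _).trans (add_le_add ((norm_mul_le _ _).trans (sq _).ge) ?_)
      rw [Algebra.algebraMap_eq_smul_one, norm_smul]
      have : ‖(1 : B)‖ ≤ 1 := by
        rcases subsingleton_or_nontrivial B with h | h
        · rw [Subsingleton.elim (1 : B) 0, norm_zero]; exact zero_le_one
        · exact CStarRing.norm_one.le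
      calc _ ≤ ‖(t : ℂ) ^ 2‖ * 1 := by gcongr
        _ = t ^ 2 := by simp
    have h2 : ‖f b‖ ^ 2 ≤ ‖b‖ ^ 2 := by gcongr; exact hc b
    have h3 : ((f a).im + t) ^ 2 ≤ ‖f b‖ ^ 2 := by
      rw [hfb, ← Complex.normSq_eq_norm_sq, Complex.normSq_apply]
      simp
      nlinarith [sq_nonneg (f a).re]
    exact h3.trans (h2.trans hn)
  by_contra h
  -- This `t` makes the cross term `2 t Im (f a)` equal to `‖a‖ ^ 2 + 1`, which is too large.
  have := key ((‖a‖ ^ 2 + 1) / (2 * (f a).im))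
  have h4 : 2 * (f a).im * ((‖a‖ ^ 2 + 1) / (2 * (f a).im)) = ‖a‖ ^ 2 + 1 := by field_simp
  nlinarith [sq_nonneg (f a).im]

/-- Contractive unital functionals on a C⋆-algebra are positive. -/
theorem nonneg_of_contractive {B : Type*} [CStarAlgebra B] (f : B →ₗ[ℂ] ℂ) (h1 : f 1 = 1)
    (hc : ∀ x, ‖f x‖ ≤ ‖x‖) {a : B} (ha : IsStarSquare a) : 0 ≤ f a := by
  obtain ⟨hs, hn⟩ := isStarSquare_iff_norm_sub_le.1 ha
  refine Complex.nonneg_iff.2 ⟨?_, (im_eq_zero_of_contractive f h1 hc hs).symm⟩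
  have h := (Complex.re_le_norm _).trans ((hc _).trans hn)
  rw [map_sub, Algebra.algebraMap_eq_smul_one, map_smul, h1] at h
  simp at h
  linarith

/-! ### Positive functionals on operator systems -/

section OperatorSystem

variable {B : Type*} [CStarAlgebra B] {E : Submodule ℂ B}

theorem IsOperatorSystem.realPart_mem (hE : IsOperatorSystem E) {x : B} (hx : x ∈ E) :
    (ℜ x : B) ∈ E := by
  rw [realPart_apply_coe]
  exact (E.restrictScalars ℝ).smul_mem _ (E.add_mem hx (hE.star_mem x hx))

theorem IsOperatorSystem.imaginaryPart_mem (hE : IsOperatorSystem E) {x : B} (hx : x ∈ E) :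
    (ℑ x : B) ∈ E := by
  have h := E.neg_mem (hE.realPart_mem (E.smul_mem Complex.I hx))
  rwa [realPart_I_smul, AddSubgroup.coe_neg, neg_neg] at h

theorem norm_le_of_isSelfAdjoint (hE : IsOperatorSystem E) (φ : E →ₗ[ℂ] ℂ)
    (h1 : φ ⟨1, hE.one_mem⟩ = 1) (hpos : ∀ e : E, IsStarSquare (e : B) → 0 ≤ φ e) {e : E}
    (he : IsSelfAdjoint (e : B)) : (φ e).im = 0 ∧ (φ e).re ≤ ‖(e : B)‖ := by
  let := CStarAlgebra.spectralOrder B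
  have := CStarAlgebra.spectralOrderedRing B
  have h : 0 ≤ φ ((‖(e : B)‖ : ℂ) • ⟨1, hE.one_mem⟩ - e) := by
    refine hpos _ (isStarSquare_iff_nonneg.2 ?_)
    have h := he.le_algebraMap_norm_self
    rw [IsScalarTower.algebraMap_apply ℝ ℂ B, Algebra.algebraMap_eq_smul_one (A := B)] at h
    simpa using h
  rw [map_sub, map_smul, h1, Complex.nonneg_iff] at h
  simp at h
  exact ⟨h.2, h.1⟩

theorem norm_le_of_positive (hE : IsOperatorSystem E) (φ : E →ₗ[ℂ] ℂ)
    (h1 : φ ⟨1, hE.one_mem⟩ = 1) (hpos : ∀ e : E, IsStarSquare (e : B) → 0 ≤ φ e) (e : E) :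
    ‖φ e‖ ≤ ‖e‖ := by
  rcases eq_or_ne (φ e) 0 with h0 | h0
  · rw [h0, norm_zero]; exact norm_nonneg _
  -- Rotating `e` makes its value real and nonnegative; only the real part of `u • e` then
  -- contributes, and the self-adjoint bound applies to it.
  obtain ⟨u, hu, hue⟩ : ∃ u : ℂ, ‖u‖ = 1 ∧ u * φ e = ‖φ e‖ :=
    (RCLike.exists_norm_eq_mul_self (φ e)).imp fun u h => ⟨h.1, h.2.symm⟩
  set x : E := u • e with hx
  have hxe : (⟨ℜ (x : B), hE.realPart_mem x.2⟩ : E) +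
      Complex.I • (⟨ℑ (x : B), hE.imaginaryPart_mem x.2⟩ : E) = x :=
    Subtype.ext (realPart_add_I_smul_imaginaryPart (x : B))
  have hφx : φ x = ‖φ e‖ := by rw [hx, map_smul, smul_eq_mul, hue]
  have hr := norm_le_of_isSelfAdjoint hE φ h1 hpos
    (e := ⟨ℜ (x : B), hE.realPart_mem x.2⟩) (ℜ (x : B)).2
  have hi := norm_le_of_isSelfAdjoint hE φ h1 hpos
    (e := ⟨ℑ (x : B), hE.imaginaryPart_mem x.2⟩) (ℑ (x : B)).2
  have h3 := congrArg Complex.re (congrArg φ hxe)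
  rw [map_add, map_smul, smul_eq_mul, Complex.add_re, Complex.mul_re, hi.1, hφx,
    Complex.ofReal_re, Complex.I_re, Complex.I_im, zero_mul, mul_zero, sub_zero, add_zero] at h3
  rw [← h3]
  refine hr.2.trans ((realPart.norm_le (x : B)).trans ?_)
  simp [hx, norm_smul, hu]

/-- Positive unital functionals on operator systems extend to the ambient C⋆-algebra. -/
theorem exists_extension_functional (hE : IsOperatorSystem E) (φ : E →ₗ[ℂ] ℂ)
    (h1 : φ ⟨1, hE.one_mem⟩ = 1) (hpos : ∀ e : E, IsStarSquare (e : B) → 0 ≤ φ e) :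
    ∃ ψ : B →ₗ[ℂ] ℂ, (∀ e : E, ψ e = φ e) ∧ ∀ x, ‖ψ x‖ ≤ ‖x‖ := by
  let f : StrongDual ℂ E := φ.mkContinuous 1 fun e => by
    rw [one_mul]; exact norm_le_of_positive hE φ h1 hpos e
  obtain ⟨g, hg, hgn⟩ := exists_extension_norm_eq E f
  refine ⟨g, hg, fun x => (g.le_opNorm x).trans ?_⟩
  rw [hgn]
  exact mul_le_of_le_one_left (norm_nonneg _) (φ.mkContinuous_norm_le zero_le_one _)

end OperatorSystem

/-! ### Positive matrices; positive maps into commutative algebras -/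

theorem MatrixPositive.isStarSquare_sum {B : Type*} [CStarAlgebra B] {n : ℕ}
    {M : Matrix (Fin n) (Fin n) B} (hM : MatrixPositive M) (v : Fin n → ℂ) :
    IsStarSquare (∑ i, ∑ j, (star (v i) * v j) • M i j) := by
  obtain ⟨X, rfl⟩ := hM
  have : ∑ i, ∑ j, (star (v i) * v j) • (X.conjTranspose * X) i j =
      ∑ k, star (∑ j, v j • X k j) * ∑ j, v j • X k j := by
    simp only [Matrix.mul_apply, Matrix.conjTranspose_apply, star_sum, star_smul,
      Finset.sum_mul_sum, Finset.smul_sum, smul_mul_smul_comm]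
    rw [Finset.sum_comm]
    conv_rhs => rw [Finset.sum_comm]
    rw [Finset.sum_comm]
    exact Finset.sum_congr rfl fun i _ => Finset.sum_comm
  rw [this]
  exact .sum _ fun k _ => ⟨_, rfl⟩

/-- Over a commutative C⋆-algebra, a matrix is positive as soon as its quadratic form takes
positive values on scalar vectors. -/
theorem matrixPositive_of_isStarSquare_sum {K : Type*} [CommCStarAlgebra K] {n : ℕ}
    {M : Matrix (Fin n) (Fin n) K}
    (h : ∀ v : Fin n → ℂ, IsStarSquare (∑ i, ∑ j, (star (v i) * v j) • M i j)) :
    MatrixPositive M := by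
  have hχ : ∀ χ : WeakDual.characterSpace ℂ K, (M.map χ).PosSemidef := by
    intro χ
    rw [← Matrix.isPositive_toEuclideanLin_iff, LinearMap.isPositive_iff_complex]
    intro x
    have h1 : (inner ℂ ((M.map χ).toEuclideanLin x) x : ℂ) =
        star (χ (∑ i, ∑ j, (star (x i) * x j) • M i j)) := by
      simp [PiLp.inner_apply, Matrix.toLpLin_apply, Matrix.mulVec, dotProduct, Finset.mul_sum,
        mul_comm, mul_left_comm]
    have h2 : 0 ≤ χ (∑ i, ∑ j, (star (x i) * x j) • M i j) := by
      obtain ⟨y, hy⟩ := h x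
      rw [hy, map_mul, map_star]
      exact star_mul_self_nonneg _
    rw [h1, (IsSelfAdjoint.of_nonneg h2).star_eq]
    exact ⟨Complex.ext (by simp) (by simpa using (Complex.nonneg_iff.1 h2).2),
      (Complex.nonneg_iff.1 h2).1⟩
  let N : CStarMatrix (Fin n) (Fin n) K := CStarMatrix.ofMatrix M
  have hsa : IsSelfAdjoint N := by
    refine CStarMatrix.ext fun i j => ?_
    rw [CStarMatrix.star_apply]
    refine (gelfandStarTransform K).injective (ContinuousMap.ext fun χ => ?_)
    change χ (star (M j i)) = χ (M i j)
    rw [map_star]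
    exact (hχ χ).1.apply i j
  let := CStarAlgebra.spectralOrder K
  have := CStarAlgebra.spectralOrderedRing K
  let := CStarAlgebra.spectralOrder (CStarMatrix (Fin n) (Fin n) K)
  have := CStarAlgebra.spectralOrderedRing (CStarMatrix (Fin n) (Fin n) K)
  have hN : 0 ≤ N := by
    rw [StarOrderedRing.nonneg_iff_spectrum_nonneg (R := ℂ) N hsa.isStarNormal]
    intro z hz
    -- A spectral value `z` of `M` makes `det (z - M)` a non-unit of `K`, hence killed by a
    -- character `χ`. So `z` is an eigenvalue of the positive semidefinite scalar matrix `M.map χ`.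
    have hz' : ¬ IsUnit (z • (1 : Matrix (Fin n) (Fin n) K) - M) := fun hu => hz (by
      have := hu.map (CStarMatrix.ofMatrixRingEquiv (n := Fin n) (A := K))
      rw [spectrum.mem_resolventSet_iff, Algebra.algebraMap_eq_smul_one]
      exact this)
    rw [Matrix.isUnit_iff_isUnit_det] at hz'
    obtain ⟨χ, hχ0⟩ := WeakDual.CharacterSpace.exists_apply_eq_zero hz'
    have hdet : (z • (1 : Matrix (Fin n) (Fin n) ℂ) - M.map χ).det = 0 := by
      rw [← hχ0]
      have := RingHom.map_det (χ : K →+* ℂ) (z • (1 : Matrix (Fin n) (Fin n) K) - M)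
      refine Eq.trans ?_ this.symm
      congr 1
      ext i j
      by_cases hij : i = j <;> simp [hij]
    obtain ⟨v, hv, hv0⟩ := Matrix.exists_mulVec_eq_zero_iff.2 hdet
    rw [Matrix.sub_mulVec, Matrix.smul_mulVec, Matrix.one_mulVec, sub_eq_zero] at hv0
    have h1 := (hχ χ).dotProduct_mulVec_nonneg v
    rw [← hv0, dotProduct_smul, smul_eq_mul] at h1
    obtain ⟨hq, hq'⟩ := Complex.pos_iff.1 (Matrix.dotProduct_star_self_pos_iff.2 hv)
    rw [Complex.nonneg_iff, Complex.mul_re, Complex.mul_im, ← hq', mul_zero, mul_zero, sub_zero,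
      zero_add] at h1
    exact Complex.nonneg_iff.2 ⟨nonneg_of_mul_nonneg_left h1.1 hq,
      ((mul_eq_zero.1 h1.2.symm).resolve_right hq.ne').symm⟩
  obtain ⟨Y, hY⟩ := isStarSquare_iff_nonneg.2 hN
  exact ⟨CStarMatrix.ofMatrix.symm Y, hY⟩

/-- A positive linear map from an operator system into a commutative C⋆-algebra is completely
positive. -/
theorem matrixPositive_map_of_positive {B K : Type*} [CStarAlgebra B] [CommCStarAlgebra K]
    {E : Submodule ℂ B} (φ : E →ₗ[ℂ] K) (hφ : ∀ e : E, IsStarSquare (e : B) → IsStarSquare (φ e))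
    {n : ℕ} (M : Matrix (Fin n) (Fin n) E) (hM : MatrixPositive (M.map fun e => (e : B))) :
    MatrixPositive (M.map φ) := by
  refine matrixPositive_of_isStarSquare_sum fun v => ?_
  have := hφ (∑ i, ∑ j, (star (v i) * v j) • M i j)
    (by simpa using hM.isStarSquare_sum v)
  simpa [map_sum, map_smul] using this

/-- A positive linear map into a commutative C⋆-algebra is completely positive. -/
theorem isCompletelyPositive_of_positive {B K : Type*} [CStarAlgebra B] [CommCStarAlgebra K]
    (φ : B →ₗ[ℂ] K) (hφ : ∀ b : B, IsStarSquare b → IsStarSquare (φ b)) :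
    IsCompletelyPositive φ := by
  refine fun n M hM => matrixPositive_of_isStarSquare_sum fun v => ?_
  have := hφ _ (hM.isStarSquare_sum v)
  simpa [map_sum, map_smul] using this

theorem matrixPositive_one_iff {B : Type*} [Ring B] [StarRing B]
    {M : Matrix (Fin 1) (Fin 1) B} : MatrixPositive M ↔ IsStarSquare (M 0 0) := by
  constructor
  · rintro ⟨X, rfl⟩
    exact ⟨X 0 0, by simp [Matrix.mul_apply]⟩
  · rintro ⟨y, hy⟩
    refine ⟨Matrix.of fun _ _ => y, ?_⟩
    ext i j
    rw [Subsingleton.elim i 0, Subsingleton.elim j 0, hy]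
    simp [Matrix.mul_apply]

theorem MatrixPositive.map {B C : Type*} [Ring B] [StarRing B] [Algebra ℂ B] [Ring C] [StarRing C]
    [Algebra ℂ C] (κ : B →⋆ₐ[ℂ] C) {n : ℕ} {M : Matrix (Fin n) (Fin n) B}
    (h : MatrixPositive M) : MatrixPositive (M.map κ) := by
  obtain ⟨X, rfl⟩ := h
  refine ⟨X.map κ, ?_⟩
  ext i j
  simp [Matrix.mul_apply, map_star]

theorem IsCompletelyPositive.isStarSquare {B C : Type*} [Ring B] [StarRing B] [Algebra ℂ B]
    [Ring C] [StarRing C] [Algebra ℂ C] {φ : B →ₗ[ℂ] C} (hφ : IsCompletelyPositive φ) {b : B}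
    (hb : IsStarSquare b) : IsStarSquare (φ b) :=
  matrixPositive_one_iff.1 (hφ 1 (Matrix.of fun _ _ => b) (matrixPositive_one_iff.2 hb))

theorem IsUCP.isStarSquare {B C : Type*} [CStarAlgebra B] [CStarAlgebra C] {E : Submodule ℂ B}
    {S : Submodule ℂ C} {φ : E →ₗ[ℂ] S} (hφ : IsUCP φ) {e : E} (he : IsStarSquare (e : B)) :
    IsStarSquare (φ e : C) :=
  matrixPositive_one_iff.1 (hφ.map_pos 1 (Matrix.of fun _ _ => e) (matrixPositive_one_iff.2 he))

theorem ContinuousMap.isStarSquare_iff {X : Type*} [TopologicalSpace X] {f : C(X, ℂ)} :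
    IsStarSquare f ↔ ∀ x, 0 ≤ f x := by
  constructor
  · rintro ⟨y, rfl⟩ x
    exact star_mul_self_nonneg (y x)
  · intro h
    refine ⟨⟨fun x => (Real.sqrt (f x).re : ℂ), by fun_prop⟩, ?_⟩
    ext x
    obtain ⟨h1, h2⟩ := Complex.nonneg_iff.1 (h x)
    simp only [ContinuousMap.mul_apply, ContinuousMap.star_apply, ContinuousMap.coe_mk,
      RCLike.star_def, Complex.conj_ofReal, ← Complex.ofReal_mul, Real.mul_self_sqrt h1]
    exact Complex.ext rfl h2.symm

theorem isStarSquare_iff_character {K : Type*} [CommCStarAlgebra K] {a : K} :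
    IsStarSquare a ↔ ∀ χ : WeakDual.characterSpace ℂ K, 0 ≤ χ a := by
  refine ⟨fun ⟨y, hy⟩ χ => ?_, fun h => ?_⟩
  · rw [hy, map_mul, map_star]
    exact star_mul_self_nonneg _
  · have := (ContinuousMap.isStarSquare_iff (f := gelfandStarTransform K a)).2 h
    simpa using this.map (gelfandStarTransform K).symm

/-! ### Projective covers and injectivity of `C(G, ℂ)` -/

theorem projective_ultrafilter (X : Type u) : CompactT2.Projective (Ultrafilter X) := by
  intro Y Z _ _ _ _ _ _ f g hf hg hs
  -- Any set-theoretic lift on principal ultrafilters extends continuously, the target being compact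
  -- Hausdorff.
  let t : X → Y := fun x => Function.surjInv hs (f (pure x))
  refine ⟨Ultrafilter.extend t, continuous_ultrafilter_extend t,
    denseRange_pure.equalizer (hg.comp (continuous_ultrafilter_extend t)) hf ?_⟩
  ext x
  simp only [Function.comp_apply, ultrafilter_extend_pure]
  exact Function.surjInv_eq hs _

/-- Every compact Hausdorff space has a projective cover: a projective space with an irreducible
surjection onto it. -/
theorem exists_projective_cover (X : Type u) [TopologicalSpace X] [CompactSpace X] [T2Space X] :
    ∃ (G : Type u) (_ : TopologicalSpace G) (_ : CompactSpace G) (_ : T2Space G) (π : C(G, X)),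
      CompactT2.Projective G ∧ Function.Surjective π ∧
        ∀ F : Set G, IsClosed F → π '' F = Set.univ → F = Set.univ := by
  let p : Ultrafilter X → X := Ultrafilter.extend id
  have hp : Continuous p := continuous_ultrafilter_extend id
  have hps : Function.Surjective p := fun x => ⟨pure x, ultrafilter_extend_pure id x⟩
  -- `G` is a minimal closed subset of the ultrafilter space still mapping onto `X`; minimality is
  -- irreducibility.
  obtain ⟨G, hG, hGs, hmin⟩ := exists_compact_surjective_zorn_subset hp hps
  let π : C(G, X) := ⟨G.domRestrict p, hp.comp continuous_subtype_val⟩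
  have hirr : ∀ F : Set G, IsClosed F → π '' F = Set.univ → F = Set.univ := fun F hF h => by
    by_contra hne
    exact hmin F hne hF h
  have hπ : Function.Surjective π := fun x => by
    obtain ⟨y, hy, rfl⟩ := hGs.symm ▸ Set.mem_univ x
    exact ⟨⟨y, hy⟩, rfl⟩
  obtain ⟨r, hr, hrπ⟩ := projective_ultrafilter X hp π.continuous hπ
  -- the lift restricts to the identity of `G`, as it preserves the fibres of `π`
  have hid : ∀ g : G, r g = g := by
    intro g
    by_contra hne
    obtain ⟨U, V, hU, hV, hgU, hgV, hUV⟩ := t2_separation hne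
    -- Each point `y` of this open set has `r y` in the same fibre and outside the set, so its
    -- complement still maps onto `X`, against irreducibility.
    have hW : IsOpen (V ∩ (fun g : G => r g) ⁻¹' U) :=
      hV.inter (hU.preimage (hr.comp continuous_subtype_val))
    have := hirr _ hW.isClosed_compl (Set.eq_univ_of_forall fun x => by
      obtain ⟨y, rfl⟩ := hπ x
      by_cases hy : y ∈ V ∩ (fun g : G => r g) ⁻¹' U
      · refine ⟨r y, fun h => ?_, congrFun hrπ y⟩
        exact Set.disjoint_left.1 hUV hy.2 h.1
      · exact ⟨y, hy, rfl⟩)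
    exact Set.eq_univ_iff_forall.1 this g ⟨hgV, hgU⟩
  refine ⟨G, inferInstance, hG, inferInstance, π, ?_, hπ, hirr⟩
  intro Y Z _ _ _ _ _ _ f g hf hg hs
  -- `G` is a retract of a projective space through `r`, hence projective.
  obtain ⟨h, hh, hgh⟩ := projective_ultrafilter X (hf.comp hr) hg hs
  refine ⟨fun x => h x, hh.comp continuous_subtype_val, funext fun x => ?_⟩
  exact (congrFun hgh x).trans (congrArg f (hid x))

/-- Spaces of continuous functions on projective compact spaces are injective for positive unital
maps. -/
theorem exists_positive_extension {G : Type u} [TopologicalSpace G] [CompactSpace G] [T2Space G]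
    (hG : CompactT2.Projective G) {B : Type*} [CStarAlgebra B] {E : Submodule ℂ B}
    (hE : IsOperatorSystem E) (φ : E →ₗ[ℂ] C(G, ℂ)) (h1 : φ ⟨1, hE.one_mem⟩ = 1)
    (hpos : ∀ e : E, IsStarSquare (e : B) → IsStarSquare (φ e)) :
    ∃ Ψ : B →ₗ[ℂ] C(G, ℂ), (∀ e : E, Ψ e = φ e) ∧
      ∀ b, IsStarSquare b → IsStarSquare (Ψ b) := by
  have hext : ∀ g : G, ∃ ψ : B →ₗ[ℂ] ℂ, (∀ e : E, ψ e = φ e g) ∧ ∀ x, ‖ψ x‖ ≤ ‖x‖ := fun g =>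
    exists_extension_functional hE
      ((ContinuousMap.evalAlgHom ℂ ℂ g).toLinearMap ∘ₗ φ)
      (by simp [h1])
      (fun e he => ContinuousMap.isStarSquare_iff.1 (hpos e he) g)
  -- The functionals are chosen point by point, with no continuity in `g`. Continuity is recovered
  -- by extending `g ↦ ψ g b` to the ultrafilters on `G` and pulling back along a continuous section
  -- `r` of the limit map.
  choose ψ hψ hψn using hext
  obtain ⟨r, hr, hrid⟩ := hG continuous_id (continuous_ultrafilter_extend (id : G → G))
    (fun x => ⟨pure x, ultrafilter_extend_pure id x⟩)
  have hΛ : ∀ b : B, ∃ Λ : C(Ultrafilter G, ℂ), ∀ g, Λ (pure g) = ψ g b := by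
    intro b
    have : CompactSpace (Metric.closedBall (0 : ℂ) ‖b‖) :=
      isCompact_iff_compactSpace.1 (isCompact_closedBall _ _)
    let f : G → Metric.closedBall (0 : ℂ) ‖b‖ := fun g => ⟨ψ g b, by simpa using hψn g b⟩
    refine ⟨⟨fun x => (Ultrafilter.extend f x : Metric.closedBall (0 : ℂ) ‖b‖),
      continuous_subtype_val.comp (continuous_ultrafilter_extend f)⟩, fun g => ?_⟩
    simp [f, ultrafilter_extend_pure]
  choose Λ hΛ using hΛ
  have huniq : ∀ f₁ f₂ : C(Ultrafilter G, ℂ), (∀ g : G, f₁ (pure g) = f₂ (pure g)) → f₁ = f₂ :=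
    fun f₁ f₂ h => ContinuousMap.ext fun x => congrFun
      (denseRange_pure.equalizer f₁.continuous f₂.continuous (funext h)) x
  let Λₗ : B →ₗ[ℂ] C(Ultrafilter G, ℂ) :=
    { toFun := Λ
      map_add' := fun x y => huniq _ _ fun g => by simp [hΛ]
      map_smul' := fun c x => huniq _ _ fun g => by simp [hΛ] }
  refine ⟨(ContinuousMap.compStarAlgHom' ℂ ℂ ⟨r, hr⟩).toAlgHom.toLinearMap ∘ₗ Λₗ,
    fun e => ?_, fun b hb => ContinuousMap.isStarSquare_iff.2 fun g => ?_⟩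
  · have : Λ e = (φ e).comp ⟨Ultrafilter.extend id, continuous_ultrafilter_extend id⟩ :=
      huniq _ _ fun g => by simp [hΛ, hψ, ultrafilter_extend_pure]
    ext g
    change Λ e (r g) = φ e g
    rw [this]
    exact congrArg (φ e) (congrFun hrid g)
  · have hψ1 : ∀ g, ψ g 1 = 1 := fun g => by
      rw [hψ g ⟨1, hE.one_mem⟩, h1]; rfl
    have hcl : IsClosed {x | 0 ≤ Λ b x} := isClosed_Ici.preimage (Λ b).continuous
    have hsub : Set.range (pure : G → Ultrafilter G) ⊆ {x | 0 ≤ Λ b x} := by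
      rintro _ ⟨g, rfl⟩
      change 0 ≤ Λ b (pure g)
      rw [hΛ]
      exact nonneg_of_contractive _ (hψ1 g) (hψn g) hb
    exact hcl.closure_subset_iff.2 hsub (denseRange_pure (r g))

/-! ### Rigidity of irreducible covers -/

/-- The inclusion of the reals in the complex numbers, as a continuous map. -/
def ofRealMap : C(ℝ, ℂ) := ⟨Complex.ofReal, Complex.continuous_ofReal⟩

/-- The real part as a continuous map. -/
def reMap : C(ℂ, ℝ) := ⟨Complex.re, Complex.continuous_re⟩

/-- The imaginary part as a continuous map. -/
def imMap : C(ℂ, ℝ) := ⟨Complex.im, Complex.continuous_im⟩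

@[simp] theorem ofRealMap_apply (x : ℝ) : ofRealMap x = x := rfl

@[simp] theorem reMap_apply (z : ℂ) : reMap z = z.re := rfl

@[simp] theorem imMap_apply (z : ℂ) : imMap z = z.im := rfl

/-- Rigidity of irreducible covers. -/
theorem eq_id_of_irreducible {G X : Type*} [TopologicalSpace G] [CompactSpace G] [T2Space G]
    [TopologicalSpace X] [CompactSpace X] [T2Space X] (π : C(G, X)) (hπ : Function.Surjective π)
    (hirr : ∀ F : Set G, IsClosed F → π '' F = Set.univ → F = Set.univ)
    (Ψ : C(G, ℂ) →ₗ[ℂ] C(G, ℂ)) (hpos : ∀ f, IsStarSquare f → IsStarSquare (Ψ f))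
    (hfix : ∀ c : C(X, ℂ), Ψ (c.comp π) = c.comp π) : Ψ = LinearMap.id := by
  have hmono : ∀ (f : C(G, ℝ)) (c : C(X, ℝ)), (∀ g, c (π g) ≤ f g) →
      ∀ g, (c (π g) : ℂ) ≤ Ψ (ofRealMap.comp f) g := by
    intro f c hc g
    have h := hpos (ofRealMap.comp f -
      (ofRealMap.comp c).comp π)
      (ContinuousMap.isStarSquare_iff.2 fun g => by simpa using hc g)
    rw [map_sub, hfix, ContinuousMap.isStarSquare_iff] at h
    simpa using h g
  have him : ∀ (f : C(G, ℝ)) g, (Ψ (ofRealMap.comp f) g).im = 0 := by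
    intro f g
    have := hmono f (.const X (-‖f‖)) (fun g => (abs_le.1 (f.norm_coe_le_norm g)).1) g
    simpa using (Complex.le_def.1 this).2.symm
  have hle : ∀ (f : C(G, ℝ)) g, f g ≤ (Ψ (ofRealMap.comp f) g).re := by
    intro f g
    by_contra! hlt
    -- The open set where `Re (Ψ f) < a < f` is nonempty, so by irreducibility it contains the whole
    -- fibre over some `x₀`.
    obtain ⟨a, ha, hb⟩ := exists_between hlt
    let h : C(G, ℝ) := reMap.comp
      (Ψ (ofRealMap.comp f))
    have hU : IsOpen {x | h x < a ∧ a < f x} :=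
      (isOpen_lt h.continuous continuous_const).inter (isOpen_lt continuous_const f.continuous)
    set F : Set G := {x | h x < a ∧ a < f x}ᶜ with hF
    have hFc : IsClosed F := hU.isClosed_compl
    have hne : π '' F ≠ Set.univ := fun hu =>
      ((hirr F hFc hu).symm ▸ Set.mem_univ g : g ∈ F) ⟨ha, hb⟩
    obtain ⟨x₀, hx₀⟩ := (Set.ne_univ_iff_exists_notMem _).1 hne
    have hcl : IsClosed (π '' F) := (hFc.isCompact.image π.continuous).isClosed
    obtain ⟨k, hk0, hk1, hk⟩ := exists_continuous_zero_one_of_isClosed hcl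
      (isClosed_singleton (x := x₀)) (Set.disjoint_singleton_right.2 hx₀)
    have hfn : ∀ y, -‖f‖ ≤ f y := fun y => (abs_le.1 (f.norm_coe_le_norm y)).1
    -- A bump on `X` of height `a` at `x₀` and `-‖f‖` on `π '' F`. It lies below `f`, so `Ψ f` is at
    -- least `a` over `x₀`, a contradiction.
    let c : C(X, ℝ) := .const X (-‖f‖) + (a + ‖f‖) • k
    obtain ⟨g₀, rfl⟩ := hπ x₀
    have hg₀ : g₀ ∉ F := fun h => hx₀ ⟨g₀, h, rfl⟩
    have hga : h g₀ < a := (not_not.1 hg₀).1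
    have hc : ∀ y, c (π y) ≤ f y := by
      intro y
      by_cases hy : y ∈ F
      · have : k (π y) = 0 := hk0 ⟨y, hy, rfl⟩
        simpa [c, this] using hfn y
      · have h1 := (not_not.1 hy).2
        have h2 := hk (π y)
        have h3 : 0 ≤ a + ‖f‖ := by
          have := (Complex.le_def.1 (hmono f (.const X (-‖f‖)) hfn g)).1
          simp at this
          linarith
        simp only [c, ContinuousMap.add_apply, ContinuousMap.const_apply, ContinuousMap.smul_apply,
          smul_eq_mul]
        nlinarith [h2.2]
    have := (Complex.le_def.1 (hmono f c hc g₀)).1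
    have hk' : k (π g₀) = 1 := hk1 rfl
    simp [c, hk'] at this
    exact absurd this (not_le.2 hga)
  have heq : ∀ f : C(G, ℝ), Ψ (ofRealMap.comp f) =
      ofRealMap.comp f := by
    intro f
    ext g
    have hneg : ofRealMap.comp (-f) =
      -(ofRealMap.comp f) := by ext; simp
    have h1 := hle f g
    have h2 := hle (-f) g
    rw [hneg, map_neg] at h2
    simp at h2
    exact Complex.ext (le_antisymm h2 h1) (him f g)
  ext f g
  have hf : f = ofRealMap.comp (reMap.comp f) +
      Complex.I • ofRealMap.comp (imMap.comp f) := by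
    ext x
    simp [mul_comm Complex.I, Complex.re_add_im]
  rw [hf, map_add, map_smul, heq, heq]
  rfl

/-! ### Injective envelopes of commutative algebras -/

theorem isOperatorSystem_range {K B : Type*} [CommCStarAlgebra K] [CStarAlgebra B]
    (κ : K →⋆ₐ[ℂ] B) : IsOperatorSystem (LinearMap.range κ.toAlgHom.toLinearMap) where
  one_mem := ⟨1, map_one κ⟩
  star_mem := by
    rintro _ ⟨a, rfl⟩
    exact ⟨star a, map_star κ a⟩

theorem isOperatorSystem_top {B : Type*} [CStarAlgebra B] :
    IsOperatorSystem (⊤ : Submodule ℂ B) :=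
  ⟨trivial, fun _ _ => trivial⟩

/-- The inverse of an injective star homomorphism, on its range. -/
noncomputable def rangeSymm {K B : Type*} [CommCStarAlgebra K] [CStarAlgebra B]
    (κ : K →⋆ₐ[ℂ] B) (hκ : Function.Injective κ) :
    LinearMap.range κ.toAlgHom.toLinearMap →ₗ[ℂ] K :=
  (LinearEquiv.ofInjective κ.toAlgHom.toLinearMap hκ).symm.toLinearMap

theorem map_rangeSymm {K B : Type*} [CommCStarAlgebra K] [CStarAlgebra B]
    (κ : K →⋆ₐ[ℂ] B) (hκ : Function.Injective κ)
    (e : LinearMap.range κ.toAlgHom.toLinearMap) : κ (rangeSymm κ hκ e) = e :=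
  congrArg Subtype.val ((LinearEquiv.ofInjective κ.toAlgHom.toLinearMap hκ).apply_symm_apply e)

theorem rangeSymm_map {K B : Type*} [CommCStarAlgebra K] [CStarAlgebra B]
    (κ : K →⋆ₐ[ℂ] B) (hκ : Function.Injective κ) (a : K) :
    rangeSymm κ hκ ⟨κ a, a, rfl⟩ = a :=
  (LinearEquiv.ofInjective κ.toAlgHom.toLinearMap hκ).symm_apply_apply a

theorem isStarSquare_rangeSymm {K B : Type*} [CommCStarAlgebra K] [CStarAlgebra B]
    (κ : K →⋆ₐ[ℂ] B) (hκ : Function.Injective κ)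
    (e : LinearMap.range κ.toAlgHom.toLinearMap) (he : IsStarSquare (e : B)) :
    IsStarSquare (rangeSymm κ hκ e) :=
  .of_map κ hκ (by rwa [map_rangeSymm])

theorem exists_positive_lift {G : Type u} [TopologicalSpace G] [CompactSpace G] [T2Space G]
    (hG : CompactT2.Projective G) {K B : Type*} [CommCStarAlgebra K] [CStarAlgebra B]
    (κ : K →⋆ₐ[ℂ] B) (hκ : Function.Injective κ) (ι : K →⋆ₐ[ℂ] C(G, ℂ)) :
    ∃ Ψ : B →ₗ[ℂ] C(G, ℂ), (∀ a, Ψ (κ a) = ι a) ∧ ∀ b, IsStarSquare b → IsStarSquare (Ψ b) := by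
  obtain ⟨Ψ, h1, h2⟩ := exists_positive_extension hG (isOperatorSystem_range κ)
    (ι.toAlgHom.toLinearMap ∘ₗ rangeSymm κ hκ)
    (by
      have : (⟨1, (isOperatorSystem_range κ).one_mem⟩ : LinearMap.range κ.toAlgHom.toLinearMap) =
          ⟨κ 1, 1, rfl⟩ := Subtype.ext (map_one κ).symm
      rw [this]
      change ι (rangeSymm κ hκ ⟨κ 1, 1, rfl⟩) = 1
      rw [rangeSymm_map, map_one])
    (fun e he => (isStarSquare_rangeSymm κ hκ e he).map ι)
  refine ⟨Ψ, fun a => ?_, h2⟩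
  rw [h1 ⟨κ a, a, rfl⟩]
  exact congrArg ι (rangeSymm_map κ hκ a)

/-- `ι` embeds `K` rigidly if the identity is the only positive map which is the identity on
`K`. -/
def IsRigid {K J : Type*} [Ring K] [StarRing K] [Algebra ℂ K] [CStarAlgebra J]
    (ι : K →⋆ₐ[ℂ] J) : Prop :=
  ∀ Ψ : J →ₗ[ℂ] J, (∀ f, IsStarSquare f → IsStarSquare (Ψ f)) → (∀ a, Ψ (ι a) = ι a) →
    Ψ = LinearMap.id

theorem exists_rigid_embedding (K : Type u) [CommCStarAlgebra K] :
    ∃ (G : Type u) (_ : TopologicalSpace G) (_ : CompactSpace G) (_ : T2Space G)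
      (ι : K →⋆ₐ[ℂ] C(G, ℂ)), CompactT2.Projective G ∧ Function.Injective ι ∧ IsRigid ι := by
  obtain ⟨G, _, _, _, π, hG, hπ, hirr⟩ := exists_projective_cover (WeakDual.characterSpace ℂ K)
  refine ⟨G, _, ‹_›, ‹_›, (ContinuousMap.compStarAlgHom' ℂ ℂ π).comp
    (gelfandStarTransform K : K →⋆ₐ[ℂ] _), hG, fun a b h => ?_, fun Ψ hpos hfix => ?_⟩
  · refine (gelfandStarTransform K).injective (ContinuousMap.ext fun χ => ?_)
    obtain ⟨g, rfl⟩ := hπ χ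
    exact DFunLike.congr_fun h g
  · refine eq_id_of_irreducible π hπ hirr Ψ hpos fun c => ?_
    obtain ⟨a, rfl⟩ := (gelfandStarTransform K).surjective c
    exact hfix a

section Envelope

variable {K : Type u} [CommCStarAlgebra K] {G : Type u} [TopologicalSpace G] [CompactSpace G]
  [T2Space G]

theorem isInjectiveOperatorSystem_top (hG : CompactT2.Projective G) :
    IsInjectiveOperatorSystem (⊤ : Submodule ℂ C(G, ℂ)) := by
  refine ⟨isOperatorSystem_top, fun B _ E F hE hF hEF φ hφ => ?_⟩
  obtain ⟨Ψ, h1, h2⟩ := exists_positive_extension hG hE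
    (Submodule.subtype ⊤ ∘ₗ φ) (hφ.map_one _ rfl) (fun e he => hφ.isStarSquare he)
  refine ⟨LinearMap.codRestrict ⊤ (Ψ ∘ₗ F.subtype) (fun _ => trivial), ⟨fun e he => ?_,
    fun n M hM => ?_⟩, fun x => Subtype.ext (h1 x)⟩
  · change Ψ e = 1
    rw [he]
    exact (h1 ⟨1, hE.one_mem⟩).trans (hφ.map_one _ rfl)
  · exact matrixPositive_map_of_positive (Ψ ∘ₗ F.subtype) (fun e he => h2 e he) M hM

theorem isInjectiveEnvelope_of_isRigid (hG : CompactT2.Projective G) (ι : K →⋆ₐ[ℂ] C(G, ℂ))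
    (hι : Function.Injective ι) (hrig : IsRigid ι) : IsInjectiveEnvelope ι where
  injective_map := hι
  injective := isInjectiveOperatorSystem_top hG
  minimal S hS hSinj := by
    -- Injectivity of `S` yields a positive projection of `C(G, ℂ)` onto `S`. It fixes `K`, so
    -- rigidity makes it the identity.
    obtain ⟨ψ, hψ, hψS⟩ := hSinj.2 C(G, ℂ) S ⊤ hSinj.1 isOperatorSystem_top le_top LinearMap.id
      ⟨fun _ h => h, fun _ _ h => h⟩
    have := hrig (S.subtype ∘ₗ ψ ∘ₗ (LinearMap.id.codRestrict ⊤ fun _ => trivial))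
      (fun f hf => hψ.isStarSquare (e := ⟨f, trivial⟩) hf)
      (fun a => congrArg Subtype.val (hψS ⟨ι a, hS a⟩))
    refine eq_top_iff.2 fun f _ => ?_
    have h := LinearMap.congr_fun this f
    rw [LinearMap.id_apply] at h
    rw [← h]
    exact Subtype.property _

/-- A rigid embedding into `C(G, ℂ)`, `G` projective, factors through every injective envelope. -/
theorem exists_embedding_of_isInjectiveEnvelope (hG : CompactT2.Projective G)
    (ι : K →⋆ₐ[ℂ] C(G, ℂ)) (hι : Function.Injective ι) (hrig : IsRigid ι) {I : Type u}
    [CStarAlgebra I] (κ : K →⋆ₐ[ℂ] I) (hκ : IsInjectiveEnvelope κ) :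
    ∃ α : C(G, ℂ) →ₗ[ℂ] I, Function.Injective α ∧ IsCompletelyPositive α ∧
      ∀ a, α (ι a) = κ a := by
  obtain ⟨ψ, hψ, hψE⟩ := hκ.injective.2 C(G, ℂ) (LinearMap.range ι.toAlgHom.toLinearMap) ⊤
    (isOperatorSystem_range ι) isOperatorSystem_top le_top
    ((κ.toAlgHom.toLinearMap ∘ₗ rangeSymm ι hι).codRestrict ⊤ fun _ => trivial)
    ⟨fun e he => by
      have h1 : rangeSymm ι hι e = 1 := hι (by rw [map_rangeSymm, he, map_one])
      change κ (rangeSymm ι hι e) = 1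
      rw [h1, map_one], fun n M hM =>
      (matrixPositive_map_of_positive _ (isStarSquare_rangeSymm ι hι) M hM).map κ⟩
  let α : C(G, ℂ) →ₗ[ℂ] I :=
    Submodule.subtype ⊤ ∘ₗ ψ ∘ₗ (LinearMap.id.codRestrict ⊤ fun _ => trivial)
  have hα : ∀ a, α (ι a) = κ a := fun a =>
    (congrArg Subtype.val (hψE ⟨ι a, a, rfl⟩)).trans (congrArg κ (rangeSymm_map ι hι a))
  have hαcp : IsCompletelyPositive α := fun n M hM =>
    hψ.map_pos n (M.map fun x => ⟨x, trivial⟩) hM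
  -- A positive map back over `K`; rigidity gives `β ∘ α = id`, hence injectivity of `α`.
  obtain ⟨β, hβ, hβpos⟩ := exists_positive_lift hG κ hκ.injective_map ι
  have hβα := hrig (β ∘ₗ α) (fun f hf => hβpos _ (hαcp.isStarSquare hf))
    (fun a => by rw [LinearMap.comp_apply, hα, hβ])
  exact ⟨α, Function.LeftInverse.injective fun f => LinearMap.congr_fun hβα f, hαcp, hα⟩

end Envelope

/-! ### Segments of pseudo-expectations -/

section Infinite

variable {C : Type u} [CStarAlgebra C] {D : StarSubalgebra ℂ C}

/-- There are infinitely many pseudo-expectations as soon as two different positive maps into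
every rigid `C(G, ℂ)` extend the embedding of the subalgebra. -/
theorem hasInfinitelyManyPseudoExpectations_of_ne {K : Type u} [CommCStarAlgebra K]
    (e : K ≃⋆ₐ[ℂ] D)
    (h : ∀ (G : Type u) [TopologicalSpace G] [CompactSpace G] [T2Space G] (ι : K →⋆ₐ[ℂ] C(G, ℂ)),
      CompactT2.Projective G → Function.Injective ι → ∃ θ₀ θ₁ : C →ₗ[ℂ] C(G, ℂ), θ₀ ≠ θ₁ ∧
        (∀ x, IsStarSquare x → IsStarSquare (θ₀ x)) ∧
        (∀ x, IsStarSquare x → IsStarSquare (θ₁ x)) ∧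
        (∀ a, θ₀ (e a) = ι a) ∧ ∀ a, θ₁ (e a) = ι a) :
    HasInfinitelyManyPseudoExpectations D := by
  obtain ⟨G, _, _, _, ι, hG, hι, hrig⟩ := exists_rigid_embedding K
  have henv : IsInjectiveEnvelope ι := isInjectiveEnvelope_of_isRigid hG ι hι hrig
  refine ⟨⟨C(G, ℂ), inferInstance, ι.comp (e.symm : D →⋆ₐ[ℂ] K),
    hι.comp e.symm.injective, henv.injective, fun S hS => henv.minimal S fun a => ?_⟩, ?_⟩
  · simpa using hS (e a)
  intro I _ κ hκ
  obtain ⟨α, hαinj, hαcp, hα⟩ := exists_embedding_of_isInjectiveEnvelope hG ι hι hrig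
    (κ.comp (e : K →⋆ₐ[ℂ] D))
    ⟨hκ.injective_map.comp e.injective, hκ.injective, fun S hS => hκ.minimal S fun d => by
      simpa using hS (e.symm d)⟩
  obtain ⟨θ₀, θ₁, hne, hp₀, hp₁, he₀, he₁⟩ := h G ι hG hι
  -- The affine line through `θ₀` and `θ₁`, carried into `I`; the parameters in `[0, 1]` give
  -- positive maps.
  let Θ : ℝ → C →ₗ[ℂ] I := fun t => α ∘ₗ (θ₀ + (t : ℂ) • (θ₁ - θ₀))
  have hΘ : Function.Injective Θ := by
    intro s t hst
    have h1 : ∀ x, (s : ℂ) • (θ₁ - θ₀) x = (t : ℂ) • (θ₁ - θ₀) x := fun x => by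
      simpa using hαinj (LinearMap.congr_fun hst x)
    by_contra hst'
    refine hne (LinearMap.ext fun x => ?_)
    have h2 : ((s : ℂ) - t) • (θ₁ - θ₀) x = 0 := by rw [sub_smul, h1, sub_self]
    have h3 := (smul_eq_zero.1 h2).resolve_left (sub_ne_zero.2 (by exact_mod_cast hst'))
    exact (sub_eq_zero.1 h3).symm
  refine ((Set.Icc_infinite (zero_lt_one' ℝ)).image hΘ.injOn).mono ?_
  rintro _ ⟨t, ⟨ht0, ht1⟩, rfl⟩
  have hmap : ∀ a, (θ₀ + (t : ℂ) • (θ₁ - θ₀)) (e a) = ι a := fun a => by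
    simp [he₀, he₁]
  have hcoe : ∀ d : D, Θ t d = κ d := fun d => by
    obtain ⟨a, rfl⟩ := e.surjective d
    exact (congrArg α (hmap a)).trans (hα a)
  refine ⟨?_, fun n M hM => ?_, hcoe⟩
  · rw [← map_one κ, ← hcoe 1]; rfl
  · have := hαcp n _ (isCompletelyPositive_of_positive (θ₀ + (t : ℂ) • (θ₁ - θ₀))
      (fun x hx => ContinuousMap.isStarSquare_iff.2 fun g => ?_) n M hM)
    · exact this
    · have g₀ := ContinuousMap.isStarSquare_iff.1 (hp₀ x hx) g
      have g₁ := ContinuousMap.isStarSquare_iff.1 (hp₁ x hx) g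
      have : (θ₀ + (t : ℂ) • (θ₁ - θ₀)) x g = ((1 - t : ℝ) : ℂ) * θ₀ x g + (t : ℂ) * θ₁ x g := by
        simp; ring
      rw [this]
      have h0 : (0 : ℂ) ≤ ((1 - t : ℝ) : ℂ) := by exact_mod_cast sub_nonneg.2 ht1
      have h1 : (0 : ℂ) ≤ (t : ℂ) := by exact_mod_cast ht0
      exact add_nonneg (mul_nonneg h0 g₀) (mul_nonneg h1 g₁)

end Infinite

/-! ### The diagonal inclusion -/

theorem eq_zero_of_map_star_mul_self_eq_zero {B : Type*} [CStarAlgebra B] (f : B →ₗ[ℂ] ℂ)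
    (hf : ∀ b, IsStarSquare b → 0 ≤ f b) {y : B} (hy : f (star y * y) = 0) (x : B) :
    f (star y * x) = 0 := by
  let := CStarAlgebra.spectralOrder B
  have := CStarAlgebra.spectralOrderedRing B
  let p : B →ₚ[ℂ] ℂ := PositiveLinearMap.mk₀ f fun b hb => hf b (isStarSquare_iff_nonneg.2 hb)
  -- Cauchy–Schwarz for the GNS semi-inner product of `f`.
  have h := norm_inner_le_norm (𝕜 := ℂ) (p.toPreGNS y) (p.toPreGNS x)
  have h0 : ‖p.toPreGNS y‖ = 0 := by
    rw [p.preGNS_norm_def]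
    change √(f (star y * y)).re = 0
    rw [hy]; simp
  rw [h0, zero_mul, p.preGNS_inner_def] at h
  exact norm_le_zero_iff.1 h

section Diagonal

variable {A : Type u} [CommCStarAlgebra A] (D : StarSubalgebra ℂ A)

theorem coe_mem_diagonal (d : D) : ((d : A), d) ∈ diagonal D := ⟨d, rfl⟩

theorem mem_diagonal_iff {x : A × D} : x ∈ diagonal D ↔ x.1 = x.2 := by
  constructor
  · rintro ⟨d, rfl⟩
    rfl
  · intro h
    exact ⟨x.2, Prod.ext h.symm rfl⟩

/-- `D` is isomorphic to its diagonal copy. -/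
noncomputable def diagonalEquiv : D ≃⋆ₐ[ℂ] diagonal D :=
  StarAlgEquiv.ofInjective (D.subtype.prod (StarAlgHom.id ℂ D)) fun _ _ h => congrArg Prod.snd h

theorem isClosed_diagonal : IsClosed (diagonal D : Set (A × D)) := by
  have : (diagonal D : Set (A × D)) = {x | x.1 = x.2} := Set.ext fun x => mem_diagonal_iff D
  rw [this]
  exact isClosed_eq continuous_fst (continuous_subtype_val.comp continuous_snd)

variable [IsClosed (D : Set A)]

theorem character_nonneg_of_contractive (F : A × D →ₗ[ℂ] D) (hc : ∀ x, ‖F x‖ ≤ ‖x‖)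
    (hF : ∀ d : D, F (d, d) = d) (χ : WeakDual.characterSpace ℂ D) (x : A × D)
    (hx : IsStarSquare x) : 0 ≤ χ (F x) := by
  have hn : ∀ d : D, ‖χ d‖ ≤ ‖d‖ := fun d =>
    ((gelfandStarTransform D d).norm_coe_le_norm χ).trans
      ((AddMonoidHomClass.isometry_iff_norm _).1 (gelfandTransform_isometry D) d).le
  refine nonneg_of_contractive ((χ : D →ₐ[ℂ] ℂ).toLinearMap ∘ₗ F) ?_
    (fun x => (hn _).trans (hc x)) hx
  change χ (F 1) = 1
  have : F 1 = 1 := hF 1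
  rw [this, map_one]

/-- Contractive projections onto the diagonal are module maps. -/
theorem map_diagonal_mul (F : A × D →ₗ[ℂ] D) (hc : ∀ x, ‖F x‖ ≤ ‖x‖)
    (hF : ∀ d : D, F (d, d) = d) (d : D) (x : A × D) : F (((d : A), d) * x) = d * F x := by
  refine (gelfandStarTransform D).injective (ContinuousMap.ext fun χ => ?_)
  change χ (F (((d : A), d) * x)) = χ (d * F x)
  set f : A × D →ₗ[ℂ] ℂ := (χ : D →ₐ[ℂ] ℂ).toLinearMap ∘ₗ F with hf
  -- Since `χ c = 0`, the positive functional `χ ∘ F` kills `(c, c) * star (c, c)`, hence every `(c,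
  -- c) * x`. So `d` may be replaced by the scalar `χ d`.
  set c : D := d - algebraMap ℂ D (χ d) with hcd
  have hχc : χ c = 0 := by rw [hcd, map_sub, AlgHomClass.commutes]; simp
  have h := eq_zero_of_map_star_mul_self_eq_zero f
    (fun b hb => character_nonneg_of_contractive D F hc hF χ b hb) (y := star ((c : A), c)) (by
      have : star (star ((c : A), c)) * star ((c : A), c) = (((c * star c : D) : A), c * star c) := by
        rw [star_star]; rfl
      rw [this]
      change χ (F _) = 0
      rw [hF, map_mul, hχc, zero_mul]) x
  have h2 : (((d : A), d) : A × D) * x = star (star ((c : A), c)) * x + χ d • x := by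
    rw [star_star, hcd]
    ext <;> simp [sub_mul, Algebra.algebraMap_eq_smul_one]
  rw [h2, map_add, map_smul, map_add, map_smul, map_mul χ, smul_eq_mul]
  change f _ + _ = _
  rw [h, zero_add]

theorem hasUniqueConditionalExpectation_diagonal
    (h : ∀ θ : A →ₗ[ℂ] D, IsCompletelyPositive θ → IsBimoduleMap D θ → θ = 0) :
    HasUniqueConditionalExpectation (diagonal D) := by
  refine ⟨(diagonalEquiv D).toAlgEquiv.toLinearMap ∘ₗ LinearMap.snd ℂ A D,
    ⟨fun x => ?_, fun d => ?_⟩, fun E hE => ?_⟩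
  · change max ‖(x.2 : A)‖ ‖x.2‖ ≤ max ‖x.1‖ ‖x.2‖
    exact max_le (le_max_right _ _) (le_max_right _ _)
  · exact Subtype.ext (Prod.ext ((mem_diagonal_iff D).1 d.2).symm rfl)
  let F : A × D →ₗ[ℂ] D :=
    LinearMap.snd ℂ A D ∘ₗ (diagonal D).subtype.toAlgHom.toLinearMap ∘ₗ E
  have hc : ∀ x, ‖F x‖ ≤ ‖x‖ := fun x =>
    (le_max_right ‖(E x : A × D).1‖ ‖(E x : A × D).2‖).trans (hE.contractive x)
  have hF : ∀ d : D, F (d, d) = d := fun d =>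
    congrArg (fun x : diagonal D => (x : A × D).2) (hE.map_coe ⟨_, coe_mem_diagonal D d⟩)
  have hθ := h (F ∘ₗ LinearMap.inl ℂ A D) (isCompletelyPositive_of_positive _ fun b hb =>
    isStarSquare_iff_character.2 fun χ => character_nonneg_of_contractive D F hc hF χ _ (by
      obtain ⟨y, rfl⟩ := hb
      exact ⟨(y, 0), by ext <;> simp⟩)) (fun d₁ d₂ x => by
      have : LinearMap.inl ℂ A D (d₁ * x * d₂) =
          ((d₁ : A), d₁) * (((d₂ : A), d₂) * LinearMap.inl ℂ A D x) := by
        ext <;> simp [mul_comm, mul_left_comm]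
      rw [LinearMap.comp_apply, this, map_diagonal_mul D F hc hF, map_diagonal_mul D F hc hF,
        mul_assoc, mul_comm d₂]
      rfl)
  refine LinearMap.ext fun x => ?_
  have hFx : F x = x.2 := by
    have h1 : x = LinearMap.inl ℂ A D (x.1 - x.2) + ((x.2 : A), x.2) := by ext <;> simp
    have h2 : F (LinearMap.inl ℂ A D (x.1 - x.2)) = 0 := LinearMap.congr_fun hθ _
    rw [h1, map_add, h2, zero_add, hF]
    simp
  refine Subtype.ext (Prod.ext ?_ hFx)
  rw [(mem_diagonal_iff D).1 (E x).2]
  exact congrArg Subtype.val hFx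

theorem hasInfinitelyManyPseudoExpectations_diagonal [Nontrivial A] :
    HasInfinitelyManyPseudoExpectations (diagonal D) := by
  refine hasInfinitelyManyPseudoExpectations_of_ne (diagonalEquiv D) fun G _ _ _ ι hG hι => ?_
  obtain ⟨Ψ, h1, h2⟩ := exists_positive_lift hG D.subtype Subtype.val_injective ι
  refine ⟨ι.toAlgHom.toLinearMap ∘ₗ LinearMap.snd ℂ A D, Ψ ∘ₗ LinearMap.fst ℂ A D, fun h => ?_,
    fun x ⟨y, hy⟩ => ?_, fun x ⟨y, hy⟩ => ?_, fun a => rfl, h1⟩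
  -- At `(1, 0)` the two maps take the values `0` and `1`.
  · have h3 : ι 0 = Ψ 1 := LinearMap.congr_fun h (1, 0)
    have h4 : Ψ 1 = ι 1 := h1 1
    exact zero_ne_one (hι (h3.trans h4))
  · exact IsStarSquare.map ι ⟨y.2, congrArg Prod.snd hy⟩
  · exact h2 _ ⟨y.1, congrArg Prod.fst hy⟩

end Diagonal

/-! ### The Cantor set over the unit interval -/

/-- The integer whose binary expansion consists of the first `n` digits of a sequence. -/
def binaryPrefix : ℕ → (ℕ → Bool) → ℕ
  | 0, _ => 0
  | n + 1, b => 2 * binaryPrefix n b + (b n).toNat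

theorem continuous_binaryPrefix (n : ℕ) : Continuous (binaryPrefix n) := by
  induction n with
  | zero => exact continuous_const
  | succ n ih =>
    have : Continuous fun b : ℕ → Bool => (b n).toNat :=
      (continuous_of_discreteTopology (f := Bool.toNat)).comp (continuous_apply n)
    exact (continuous_const.mul ih).add this

/-- The difference is the value of the tail of `b`, which fills all of `[0, 1]`. Both ends are
attained, reflecting the two binary expansions of a dyadic number. -/
theorem cantorSurjection_mem_Icc (n : ℕ) (b : ℕ → Bool) :
    (binaryPrefix n b : ℝ) ≤ 2 ^ n * (cantorSurjection b : ℝ) ∧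
      2 ^ n * (cantorSurjection b : ℝ) ≤ binaryPrefix n b + 1 := by
  let d : ℕ → Fin 2 := fun i => finTwoEquiv.symm (b i)
  have hb : (cantorSurjection b : ℝ) = Real.ofDigits d := rfl
  have hsum : 2 ^ n * ∑ i ∈ Finset.range n, Real.ofDigitsTerm d i = binaryPrefix n b := by
    induction n with
    | zero => simp [binaryPrefix]
    | succ n ih =>
      have hd : ((d n : ℕ) : ℝ) = (b n).toNat := by
        cases h : b n <;> simp [d, h, finTwoEquiv]
      rw [Finset.sum_range_succ, mul_add, pow_succ', mul_assoc, ih, binaryPrefix,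
        Real.ofDigitsTerm, hd]
      push_cast
      field_simp
      ring
  rw [hb, Real.ofDigits_eq_sum_add_ofDigits d n, mul_add, hsum, ← mul_assoc]
  push_cast
  rw [mul_inv_cancel₀ (by positivity), one_mul]
  have h0 := Real.ofDigits_nonneg fun i => d (i + n)
  have h1 := Real.ofDigits_le_one fun i => d (i + n)
  constructor <;> linarith

theorem cantorSurjection_surjective : Function.Surjective cantorSurjection :=
  Real.fromBinary_surjective

theorem isClosed_cantorSubalgebra : IsClosed (cantorSubalgebra : Set C(ℕ → Bool, ℂ)) := by
  have hiso : Isometry (ContinuousMap.compStarAlgHom' ℂ ℂ cantorSurjection) := by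
    refine AddMonoidHomClass.isometry_of_norm _ fun f => le_antisymm ?_ ?_
    · exact (ContinuousMap.norm_le _ (norm_nonneg _)).2 fun b => f.norm_coe_le_norm _
    · refine (ContinuousMap.norm_le _ (norm_nonneg _)).2 fun x => ?_
      obtain ⟨b, rfl⟩ := cantorSurjection_surjective x
      exact (ContinuousMap.compStarAlgHom' ℂ ℂ cantorSurjection f).norm_coe_le_norm b
  have : (cantorSubalgebra : Set C(ℕ → Bool, ℂ)) =
      Set.range (ContinuousMap.compStarAlgHom' ℂ ℂ cantorSurjection) := rfl
  rw [this]
  exact hiso.isClosedEmbedding.isClosed_range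

/-- The element of `cantorSubalgebra` given by a function on the unit interval. -/
noncomputable def toCantor (d : C(unitInterval, ℂ)) : cantorSubalgebra :=
  ⟨ContinuousMap.compStarAlgHom' ℂ ℂ cantorSurjection d, d, rfl⟩

theorem toCantor_apply (d : C(unitInterval, ℂ)) (b : ℕ → Bool) :
    (toCantor d : C(ℕ → Bool, ℂ)) b = d (cantorSurjection b) := rfl

theorem toCantor_surjective : Function.Surjective toCantor := by
  rintro ⟨_, d, rfl⟩
  exact ⟨d, rfl⟩

variable {θ : C(ℕ → Bool, ℂ) →ₗ[ℂ] cantorSubalgebra}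

/-- The image of a function which vanishes over an open set also vanishes over that set. -/
theorem map_eq_zero_of_eqOn (hθ : IsBimoduleMap cantorSubalgebra θ) (f : C(ℕ → Bool, ℂ))
    {U : Set unitInterval} (hU : IsOpen U) (hf : ∀ b, cantorSurjection b ∈ U → f b = 0)
    {b : ℕ → Bool} (hb : cantorSurjection b ∈ U) : (θ f : C(ℕ → Bool, ℂ)) b = 0 := by
  -- A cutoff `d` in the subalgebra, supported over `U` and equal to `1` at `b`, satisfies `d * f =
  -- 0`; hence `d * θ f = 0`.
  obtain ⟨k, hk0, hk1, -⟩ := exists_continuous_zero_one_of_isClosed hU.isClosed_compl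
    (isClosed_singleton (x := cantorSurjection b)) (Set.disjoint_singleton_right.2 (not_not.2 hb))
  let d : cantorSubalgebra := toCantor ⟨fun x => (k x : ℂ), by fun_prop⟩
  have h0 : (d : C(ℕ → Bool, ℂ)) * f * (1 : cantorSubalgebra) = 0 := by
    ext b'
    by_cases h : cantorSurjection b' ∈ U
    · simp [hf b' h]
    · have : k (cantorSurjection b') = 0 := hk0 h
      simp [d, toCantor_apply, this]
  have h1 := hθ d 1 f
  rw [h0, map_zero] at h1
  have h2 := congrArg (fun x : cantorSubalgebra => (x : C(ℕ → Bool, ℂ)) b) h1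
  have h3 : k (cantorSurjection b) = 1 := hk1 rfl
  simpa [d, toCantor_apply, h3] using h2.symm

theorem map_one_eq_zero (hθ : IsBimoduleMap cantorSubalgebra θ) : θ 1 = 0 := by
  obtain ⟨h, hh⟩ := toCantor_surjective (θ 1)
  have hdyad : ∀ (n k : ℕ) (hk : (k : ℝ) / 2 ^ n ∈ unitInterval), 0 < k → k < 2 ^ n →
      h ⟨k / 2 ^ n, hk⟩ = 0 := by
    intro n k hk hk0 hkn
    set c : unitInterval := ⟨k / 2 ^ n, hk⟩ with hc
    -- A clopen indicator that is `0` over points left of `c` and `1` over points right of `c`. Over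
    -- `c` itself it takes both values, so it does not descend to `[0, 1]`.
    let f : C(ℕ → Bool, ℂ) := ⟨fun b => if k ≤ binaryPrefix n b then 1 else 0,
      (continuous_of_discreteTopology (f := fun m : ℕ => if k ≤ m then (1 : ℂ) else 0)).comp
        (continuous_binaryPrefix n)⟩
    have hf0 : ∀ b, cantorSurjection b ∈ Set.Iio c → f b = 0 := by
      intro b hb
      have hb' : (cantorSurjection b : ℝ) < k / 2 ^ n := hb
      rw [lt_div_iff₀ (by positivity), mul_comm] at hb'
      have h1 := (cantorSurjection_mem_Icc n b).1.trans_lt hb'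
      exact if_neg (not_le.2 (by exact_mod_cast h1))
    have hf1 : ∀ b, cantorSurjection b ∈ Set.Ioi c → (1 - f) b = 0 := by
      intro b hb
      have hb' : k / 2 ^ n < (cantorSurjection b : ℝ) := hb
      rw [div_lt_iff₀ (by positivity), mul_comm] at hb'
      have h1 := hb'.trans_le (cantorSurjection_mem_Icc n b).2
      have h2 : k ≤ binaryPrefix n b := Nat.lt_succ_iff.1 (by exact_mod_cast h1)
      simp [f, h2]
    obtain ⟨g, hg⟩ := toCantor_surjective (θ f)
    have hg0 : Set.EqOn g 0 (Set.Iio c) := by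
      intro x hx
      obtain ⟨b, rfl⟩ := cantorSurjection_surjective x
      rw [← toCantor_apply, hg]
      exact map_eq_zero_of_eqOn hθ f isOpen_Iio hf0 hx
    have hg1 : Set.EqOn h g (Set.Ioi c) := by
      intro x hx
      obtain ⟨b, rfl⟩ := cantorSurjection_surjective x
      have := map_eq_zero_of_eqOn hθ (1 - f) isOpen_Ioi hf1 hx
      rw [map_sub, ← hh, ← hg] at this
      exact sub_eq_zero.1 this
    -- As `c` is interior, it is a limit from both sides, and continuity gives `h c = g c = 0`.
    have hc0 : (0 : unitInterval) < c := by
      change (0 : ℝ) < k / 2 ^ n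
      positivity
    have hc1 : c < 1 := by
      change (k / 2 ^ n : ℝ) < 1
      rw [div_lt_one (by positivity)]
      exact_mod_cast hkn
    have h1 : h c = g c := hg1.closure h.continuous g.continuous
      (by rw [closure_Ioi' (a := c) ⟨1, hc1⟩]; exact Set.self_mem_Ici)
    have h2 : g c = 0 := hg0.closure g.continuous continuous_const
      (by rw [closure_Iio' (a := c) ⟨0, hc0⟩]; exact Set.self_mem_Iic)
    rw [h1, h2]
  have hdense : Dense {c | h c = 0} := by
    refine dense_of_exists_between fun {a b} hab => ?_
    have hab' : (a : ℝ) < b := hab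
    obtain ⟨n, hn⟩ := pow_unbounded_of_one_lt (1 / ((b : ℝ) - a)) one_lt_two
    rw [div_lt_iff₀ (sub_pos.2 hab')] at hn
    have hp : (0 : ℝ) < 2 ^ n := by positivity
    -- The least integer strictly above `2 ^ n * a`; it stays below `2 ^ n * b` because `2 ^ n * (b
    -- - a) > 1`.
    set k := ⌊2 ^ n * (a : ℝ)⌋₊ + 1 with hk
    have hka : (a : ℝ) < k / 2 ^ n := by
      rw [lt_div_iff₀ hp, mul_comm, hk]
      exact_mod_cast Nat.lt_floor_add_one (2 ^ n * (a : ℝ))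
    have hkb : (k / 2 ^ n : ℝ) < b := by
      rw [div_lt_iff₀ hp, hk]
      have := Nat.floor_le (mul_nonneg hp.le a.2.1)
      push_cast
      linarith
    have hk1 : (k / 2 ^ n : ℝ) < 1 := hkb.trans_le b.2.2
    refine ⟨⟨k / 2 ^ n, by positivity, hk1.le⟩, hdyad n k _ (Nat.succ_pos _) ?_, hka, hkb⟩
    rw [div_lt_one hp] at hk1
    exact_mod_cast hk1
  have hh0 : h = 0 := DFunLike.coe_injective
    (Continuous.ext_on hdense h.continuous continuous_const fun _ hx => hx)
  rw [← hh, hh0]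
  exact Subtype.ext (ContinuousMap.ext fun _ => rfl)

/-- Each point evaluation of `θ` is a positive functional killing `1`, hence zero by Cauchy–Schwarz.
-/
theorem eq_zero_of_isBimoduleMap_cantor (hcp : IsCompletelyPositive θ)
    (hθ : IsBimoduleMap cantorSubalgebra θ) : θ = 0 := by
  refine LinearMap.ext fun f => Subtype.ext (ContinuousMap.ext fun b => ?_)
  let φ : C(ℕ → Bool, ℂ) →ₗ[ℂ] ℂ := (ContinuousMap.evalAlgHom ℂ ℂ b).toLinearMap ∘ₗ
    cantorSubalgebra.subtype.toAlgHom.toLinearMap ∘ₗ θ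
  have hφ : ∀ f, IsStarSquare f → 0 ≤ φ f := fun f hf =>
    ContinuousMap.isStarSquare_iff.1 ((hcp.isStarSquare hf).map cantorSubalgebra.subtype) b
  have h1 : φ (star 1 * 1) = 0 := by
    rw [star_one, one_mul]
    change (θ 1 : C(ℕ → Bool, ℂ)) b = 0
    rw [map_one_eq_zero hθ]
    rfl
  have h2 := eq_zero_of_map_star_mul_self_eq_zero φ hφ h1 f
  rwa [star_one, one_mul] at h2
end CStarInclusion

open CStarInclusion in
theorem mainTheorem2 :
    (∀ (A : Type u) [CommCStarAlgebra A] [Nontrivial A] (D : StarSubalgebra ℂ A)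
        [IsClosed (D : Set A)],
      (∀ θ : A →ₗ[ℂ] D, IsCompletelyPositive θ → IsBimoduleMap D θ → θ = 0) →
        IsClosed (diagonal D : Set (A × D)) ∧
        HasUniqueConditionalExpectation (diagonal D) ∧
        HasInfinitelyManyPseudoExpectations (diagonal D)) ∧
    (IsClosed (cantorSubalgebra : Set C(ℕ → Bool, ℂ)) ∧
      ∀ θ : C(ℕ → Bool, ℂ) →ₗ[ℂ] cantorSubalgebra,
        IsCompletelyPositive θ → IsBimoduleMap cantorSubalgebra θ → θ = 0) ∧
    (∃ (A : Type) (_ : CommCStarAlgebra A) (D : StarSubalgebra ℂ A),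
      IsClosed (D : Set A) ∧
      HasUniqueConditionalExpectation D ∧
      HasInfinitelyManyPseudoExpectations D) := by
  have : IsClosed (cantorSubalgebra : Set C(ℕ → Bool, ℂ)) := isClosed_cantorSubalgebra
  exact ⟨fun A _ _ D _ h => ⟨isClosed_diagonal D, hasUniqueConditionalExpectation_diagonal D h,
      hasInfinitelyManyPseudoExpectations_diagonal D⟩,
    ⟨this, fun θ => eq_zero_of_isBimoduleMap_cantor⟩,
    C(ℕ → Bool, ℂ) × cantorSubalgebra, inferInstance, diagonal cantorSubalgebra,
    isClosed_diagonal cantorSubalgebra,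
    hasUniqueConditionalExpectation_diagonal cantorSubalgebra fun θ =>
      eq_zero_of_isBimoduleMap_cantor,
    hasInfinitelyManyPseudoExpectations_diagonal cantorSubalgebra⟩
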